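/- Let $G$ be a countable group and let $(X,G)$ be a dynamical system, i.e. $X$ is a compact metrizable space on which $G$ acts by homeomorphisms; let $\rho$ be a metric on $X$ inducing its topology (none of the notions below depends on the choice of $\rho$). A *sofic approximation* of $G$ is a sequence $\Sigma=(d_j,\sigma_j)_{j\in\mathbb N}$ of integers $d_j\ge 1$ and maps $\sigma_j\colon G\to\mathrm{Sym}(d_j)$, $s\mapsto\sigma_{j,s}$, into the group of permutations of $[d_j]=\{1,\dots,d_j\}$, such that $d_j\to\infty$, $\eta_{d_j}(\sigma_{j,s}\sigma_{j,t},\sigma_{j,st})\to 0$ for all $s,t\in G$, and $\eta_{d_j}(\sigma_{j,s},\sigma_{j,t})\to 1$ for all distinct $s,t\in G$, where $\eta_d(\sigma,\tau)=\frac1d|\{a\in[d]:\sigma(a)\ne\tau(a)\}|$. The group $G$ is *sofic* if it has a sofic approximation. * $(X,G)$ is *expansive* if there is $c>0$ such that for all distinct $x,y\in X$ there is $g\in G$ with $\rho(gx,gy)>c$. * $(X,G)$ has the *weak specification property* if for every $\varepsilon>0$ there is a finite symmetric set $F\subset G$ containing $1_G$ such that for every finite family $(\Omega_i)_{i\in I}$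 of finite subsets of $G$ with $F\Omega_i\cap\Omega_j=\varnothing$ for all distinct $i,j\in I$, and every family $(x_i)_{i\in I}$ in $X$, there is $x\in X$ with $\rho(sx,sx_i)\le\varepsilon$ for all $i\in I$ and $s\in\Omega_i$. * $(X,G)$ has the *strong topological Markov property* if for every $\varepsilon>0$ there are $\delta>0$ and a finite set $F\subset G$ containing $1_G$ such that for every finite $A\subset G$ and all $x,y\in X$ with $\rho(sx,sy)\le\delta$ for all $s\in FA\setminus A$, there is $z\in X$ with $\rho(sz,sx)\le\varepsilon$ for all $s\in FA$ and $\rho(sz,sy)\le\varepsilon$ for all $s\in G\setminus A$. For $\varphi,\psi\colon[d]\to X$ put $\rho_2(\varphi,\psi)=\big(\frac1d\sum_{a\in[d]}\rho(\varphi(a),\psi(a))^2\big)^{1/2}$ and $\rho_\infty(\varphi,\psi)=\max_{a\in[d]}\rho(\varphi(a),\psi(a))$. For a nonempty finite $F\subset G$, $\delta>0$ and $\sigma\colon G\to\mathrm{Sym}(d)$, $s\mapsto\sigma_s$, let $\mathrm{Map}(X,\rho,F,\delta,\sigma)$ be the set of all $\varphi\colon[d]\to X$ with $\rho_2(\varphi\circ\sigma_s,s\varphi)<\delta$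 for all $s\in F$, where $(s\varphi)(a)=s\varphi(a)$, and let $N_\varepsilon(\cdot,\rho_\infty)$ denote the maximal cardinality of a subset any two distinct elements of which are at $\rho_\infty$-distance at least $\varepsilon$. The *sofic topological entropy* is $$h_\Sigma(X,G)=\sup_{\varepsilon>0}\ \inf_{F}\ \inf_{\delta>0}\ \limsup_{j\to\infty}\frac1{d_j}\log N_\varepsilon\big(\mathrm{Map}(X,\rho,F,\delta,\sigma_j),\rho_\infty\big)\in\{-\infty\}\cup[0,+\infty],$$ where $F$ runs over the nonempty finite subsets of $G$ and $\log 0=-\infty$. **Theorem.** Let $G$ be a countable sofic group and let $(X,G)$ be an expansive dynamical system with the weak specification property and the strong topological Markov property. Assume that $h_\Sigma(X,G)\ge 0$ for some sofic approximation $\Sigma$ of $G$. Then $(X,G)$ is surjunctive: every injective continuous $G$-equivariant map $f\colon X\to X$ is surjective. -/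

import Mathlib

open Filter Topology
open scoped Pointwise

/-- The normalized Hamming distance on the symmetric group of degree `d`. -/
noncomputable def normHamming {d : ℕ} (σ τ : Equiv.Perm (Fin d)) : ℝ :=
  (hammingDist (⇑σ) (⇑τ) : ℝ) / (d : ℝ)

/-- A sofic approximation of a group `G`: a sequence of positive integers `d j → ∞` and of maps
`σ j : G → Sym(d j)` that are asymptotically multiplicative and asymptotically free with respect
to the normalized Hamming distance. -/
structure SoficApproximation (G : Type*) [Group G] where
  d : ℕ → ℕ
  d_pos : ∀ j, 0 < d j
  σ : (j : ℕ) → G → Equiv.Perm (Fin (d j))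
  tendsto_d : Tendsto d atTop atTop
  tendsto_mul : ∀ s t : G,
    Tendsto (fun j => normHamming (σ j s * σ j t) (σ j (s * t))) atTop (𝓝 0)
  tendsto_free : ∀ s t : G, s ≠ t →
    Tendsto (fun j => normHamming (σ j s) (σ j t)) atTop (𝓝 1)

/-- Soficity; to be used for countable groups. -/
def IsSoficGroup (G : Type*) [Group G] : Prop :=
  Nonempty (SoficApproximation G)

/-- The metric `ρ` induces the given topology of `X`. -/
def IsCompatibleMetric {X : Type*} [t : TopologicalSpace X] (ρ : MetricSpace X) : Prop :=
  ρ.toPseudoMetricSpace.toUniformSpace.toTopologicalSpace = t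

section Properties

variable (G X : Type*) [Group G] [TopologicalSpace X] [MulAction G X]

/-- Expansivity. On a compact space the choice of the compatible metric is irrelevant, here and in
the next two definitions. -/
def IsExpansiveAction : Prop :=
  ∃ ρ : MetricSpace X, IsCompatibleMetric ρ ∧
    ∃ c : ℝ, 0 < c ∧ ∀ x y : X, x ≠ y → ∃ g : G, c < ρ.dist (g • x) (g • y)

/-- The weak specification property. -/
def HasWeakSpecification : Prop :=
  ∃ ρ : MetricSpace X, IsCompatibleMetric ρ ∧
    ∀ ε : ℝ, 0 < ε → ∃ F : Set G, F.Finite ∧ F⁻¹ = F ∧ 1 ∈ F ∧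
      ∀ (n : ℕ) (Ω : Fin n → Set G), (∀ i, (Ω i).Finite) →
        (∀ i j, i ≠ j → (F * Ω i) ∩ Ω j = ∅) →
        ∀ x : Fin n → X, ∃ z : X, ∀ i, ∀ s ∈ Ω i, ρ.dist (s • z) (s • x i) ≤ ε

/-- The strong topological Markov property. -/
def HasStrongTMP : Prop :=
  ∃ ρ : MetricSpace X, IsCompatibleMetric ρ ∧
    ∀ ε : ℝ, 0 < ε → ∃ δ : ℝ, 0 < δ ∧ ∃ F : Set G, F.Finite ∧ 1 ∈ F ∧
      ∀ (A : Set G), A.Finite → ∀ x y : X,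
        (∀ s ∈ (F * A) \ A, ρ.dist (s • x) (s • y) ≤ δ) →
        ∃ z : X, (∀ s ∈ F * A, ρ.dist (s • z) (s • x) ≤ ε) ∧
          (∀ s ∈ Aᶜ, ρ.dist (s • z) (s • y) ≤ ε)

/-- Every injective endomorphism of `(X, G)` is surjective. -/
def IsSurjunctiveAction : Prop :=
  ∀ f : X → X, Continuous f → (∀ (g : G) (x : X), f (g • x) = g • f x) →
    Function.Injective f → Function.Surjective f

end Properties

section Entropy

/-- The metric `ρ₂` on `X ^ d`. -/
noncomputable def rhoTwo {X : Type*} (ρ : MetricSpace X) {d : ℕ} (φ ψ : Fin d → X) : ℝ :=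
  Real.sqrt ((1 / (d : ℝ)) * ∑ a : Fin d, (ρ.dist (φ a) (ψ a)) ^ 2)

/-- The metric `ρ_∞` on `X ^ d`, the maximum over the coordinates (for `d ≥ 1`). -/
noncomputable def rhoInfty {X : Type*} (ρ : MetricSpace X) {d : ℕ} (φ ψ : Fin d → X) : ℝ :=
  ⨆ a : Fin d, ρ.dist (φ a) (ψ a)

/-- `Map(X, ρ, F, δ, σ)`: the maps `φ : [d] → X` with `ρ₂(φ ∘ σ_s, s φ) < δ` for all `s ∈ F`. -/
def soficMap {G X : Type*} [Group G] [MulAction G X] (ρ : MetricSpace X) (F : Finset G) (δ : ℝ)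
    {d : ℕ} (σ : G → Equiv.Perm (Fin d)) : Set (Fin d → X) :=
  {φ | ∀ s ∈ F, rhoTwo ρ (φ ∘ σ s) (fun a => s • φ a) < δ}

/-- The maximal cardinality of a `(ρ_∞, ε)`-separated (`ρ_∞ ≥ ε` for distinct points) finite subset
of `M`. -/
noncomputable def maxSeparated {X : Type*} (ρ : MetricSpace X) (ε : ℝ) {d : ℕ}
    (M : Set (Fin d → X)) : ℕ∞ :=
  ⨆ (Z : Finset (Fin d → X)) (_ : (Z : Set (Fin d → X)) ⊆ M)
    (_ : ∀ φ ∈ Z, ∀ ψ ∈ Z, φ ≠ ψ → ε ≤ rhoInfty ρ φ ψ), (Z.card : ℕ∞)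

/-- The sofic topological entropy computed with the metric `ρ`. Here `ENNReal.log 0 = ⊥`, so that
the entropy is `-∞` when there are eventually no approximately equivariant maps. -/
noncomputable def soficEntropyOf {G X : Type*} [Group G] [MulAction G X]
    (S : SoficApproximation G) (ρ : MetricSpace X) : EReal :=
  ⨆ (ε : ℝ) (_ : 0 < ε), ⨅ (F : Finset G) (_ : F.Nonempty), ⨅ (δ : ℝ) (_ : 0 < δ),
    limsup (fun j : ℕ =>
      ENNReal.log ((maxSeparated ρ ε (soficMap ρ F δ (S.σ j)) : ℕ∞) : ENNReal) /
        ((S.d j : ℕ) : EReal)) atTop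

/-- The sofic topological entropy `h_S(X, G)` of a continuous action on a compact metrizable space,
computed with a fixed compatible metric (the value does not depend on which one). -/
noncomputable def soficEntropy {G : Type*} [Group G] (S : SoficApproximation G) (X : Type*)
    [TopologicalSpace X] [TopologicalSpace.MetrizableSpace X] [MulAction G X] : EReal :=
  soficEntropyOf S (TopologicalSpace.metrizableSpaceMetric X)

end Entropy

/-! ### Independence of the compatible metric. -/

section CompatibleMetrics

/-! If `f` is injective but not surjective, the compact set `f(X)` misses a ball around some `u`.
Patterns near `u` are then extra room that the maps `f ∘ φ`, with `φ` approximately equivariant,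
never use, and counting that room contradicts nonnegative entropy.

Take a separated family of approximately equivariant maps `φ : [d] → X`. Injectivity and expansivity
keep the `f ∘ φ` separated, up to moving by a finite set of group elements. Choose a well-spread set
`C ⊆ [d]` of positive density. For each `S ⊆ C`, modify `f ∘ φ` near `S` so that it passes close to
`u` at the points of `S` (`exists_sofic_surgery`). Weak specification and the Markov property modify
single orbits; expansivity makes the orbit-wise choices fit together. Different `S` are told apart
by `u`. For fixed `S` the surgery erases `φ` on at most `|A||S|` points, so a proportion `k ^ |S|`
of the family survives with its separation intact. Summing over `S` multiplies the family by `(1 +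
k) ^ |C|`, up to a subexponential-type loss `exp (γ d)` from exceptional points
(`exists_larger_separated_family`).

Hence any exponential growth bound `b` improves to `b - γ`, with `γ` independent of `b`
(`exists_growth_drop`). Iterating makes the bound negative, so eventually no approximately
equivariant map is left, whereas nonnegative entropy supplies one for infinitely many `j`. -/

theorem IsCompatibleMetric.exists_dist_lt {X : Type*} [t : TopologicalSpace X] [CompactSpace X]
    {ρ₁ ρ₂ : MetricSpace X} (h₁ : IsCompatibleMetric ρ₁) (h₂ : IsCompatibleMetric ρ₂)
    {ε : ℝ} (hε : 0 < ε) :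
    ∃ δ : ℝ, 0 < δ ∧ ∀ x y : X, ρ₁.dist x y ≤ δ → ρ₂.dist x y < ε := by
  have hu : ρ₁.toPseudoMetricSpace.toUniformSpace = ρ₂.toPseudoMetricSpace.toUniformSpace :=
    unique_uniformity_of_compact h₁ h₂
  have hmem : {p : X × X | ρ₂.dist p.1 p.2 < ε} ∈
      @uniformity X ρ₁.toPseudoMetricSpace.toUniformSpace := by
    rw [hu]
    exact @Metric.dist_mem_uniformity X ρ₂.toPseudoMetricSpace ε hε
  obtain ⟨δ, hδ, h⟩ := (@Metric.mem_uniformity_dist X ρ₁.toPseudoMetricSpace _).1 hmem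
  refine ⟨δ / 2, half_pos hδ, fun x y hxy => h (lt_of_le_of_lt hxy (half_lt_self hδ))⟩

variable {G X : Type*} [Group G] [t : TopologicalSpace X] [CompactSpace X] [MulAction G X]

theorem IsExpansiveAction.of_compatible (h : IsExpansiveAction G X) {ρ : MetricSpace X}
    (hρ : IsCompatibleMetric ρ) :
    ∃ c : ℝ, 0 < c ∧ ∀ x y : X, x ≠ y → ∃ g : G, c < ρ.dist (g • x) (g • y) := by
  obtain ⟨ρ', hρ', c, hc, h⟩ := h
  obtain ⟨δ, hδ, hd⟩ := hρ.exists_dist_lt hρ' hc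
  refine ⟨δ, hδ, fun x y hxy => ?_⟩
  obtain ⟨g, hg⟩ := h x y hxy
  exact ⟨g, lt_of_not_ge fun hle => lt_asymm hg (hd _ _ hle)⟩

theorem HasWeakSpecification.of_compatible (h : HasWeakSpecification G X) {ρ : MetricSpace X}
    (hρ : IsCompatibleMetric ρ) (ε : ℝ) (hε : 0 < ε) :
    ∃ F : Set G, F.Finite ∧ F⁻¹ = F ∧ 1 ∈ F ∧
      ∀ (n : ℕ) (Ω : Fin n → Set G), (∀ i, (Ω i).Finite) →
        (∀ i j, i ≠ j → (F * Ω i) ∩ Ω j = ∅) →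
        ∀ x : Fin n → X, ∃ z : X, ∀ i, ∀ s ∈ Ω i, ρ.dist (s • z) (s • x i) ≤ ε := by
  obtain ⟨ρ', hρ', h⟩ := h
  obtain ⟨δ, hδ, hd⟩ := hρ'.exists_dist_lt hρ hε
  obtain ⟨F, hF, hinv, h1, hF'⟩ := h δ hδ
  refine ⟨F, hF, hinv, h1, fun n Ω hΩ hdisj x => ?_⟩
  obtain ⟨z, hz⟩ := hF' n Ω hΩ hdisj x
  exact ⟨z, fun i s hs => (hd _ _ (hz i s hs)).le⟩

theorem HasStrongTMP.of_compatible (h : HasStrongTMP G X) {ρ : MetricSpace X}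
    (hρ : IsCompatibleMetric ρ) (ε : ℝ) (hε : 0 < ε) :
    ∃ δ : ℝ, 0 < δ ∧ ∃ F : Set G, F.Finite ∧ 1 ∈ F ∧
      ∀ (A : Set G), A.Finite → ∀ x y : X,
        (∀ s ∈ (F * A) \ A, ρ.dist (s • x) (s • y) ≤ δ) →
        ∃ z : X, (∀ s ∈ F * A, ρ.dist (s • z) (s • x) ≤ ε) ∧
          (∀ s ∈ Aᶜ, ρ.dist (s • z) (s • y) ≤ ε) := by
  obtain ⟨ρ', hρ', h⟩ := h
  obtain ⟨ε', hε', hd⟩ := hρ'.exists_dist_lt hρ hε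
  obtain ⟨δ', hδ', F, hF, h1, hF'⟩ := h ε' hε'
  obtain ⟨δ, hδ, hd'⟩ := hρ.exists_dist_lt hρ' hδ'
  refine ⟨δ, hδ, F, hF, h1, fun A hA x y hxy => ?_⟩
  obtain ⟨z, hz, hz'⟩ := hF' A hA x y fun s hs => (hd' _ _ (hxy s hs)).le
  exact ⟨z, fun s hs => (hd _ _ (hz s hs)).le, fun s hs => (hd _ _ (hz' s hs)).le⟩

end CompatibleMetrics

/-! ### Surgery on a single orbit. -/

section Surgery

variable {G X : Type*} [Group G] [MetricSpace X] [MulAction G X]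

/-- Simultaneous local modification of a point: near every element of a sufficiently separated
finite set `T`, the orbit of `y` can be replaced by a prescribed one passing close to `u`, while
staying close to the orbit of `y` away from `T`. -/
theorem exists_local_surgery
    (hW : ∀ ε : ℝ, 0 < ε → ∃ F : Set G, F.Finite ∧ F⁻¹ = F ∧ 1 ∈ F ∧
      ∀ (n : ℕ) (Ω : Fin n → Set G), (∀ i, (Ω i).Finite) →
        (∀ i j, i ≠ j → (F * Ω i) ∩ Ω j = ∅) →
        ∀ x : Fin n → X, ∃ z : X, ∀ i, ∀ s ∈ Ω i, dist (s • z) (s • x i) ≤ ε)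
    (hM : ∀ ε : ℝ, 0 < ε → ∃ δ : ℝ, 0 < δ ∧ ∃ F : Set G, F.Finite ∧ 1 ∈ F ∧
      ∀ (A : Set G), A.Finite → ∀ x y : X,
        (∀ s ∈ (F * A) \ A, dist (s • x) (s • y) ≤ δ) →
        ∃ z : X, (∀ s ∈ F * A, dist (s • z) (s • x) ≤ ε) ∧
          (∀ s ∈ Aᶜ, dist (s • z) (s • y) ≤ ε))
    (u : X) {e : ℝ} (he : 0 < e) :
    ∃ (A D K : Finset G) (η : ℝ) (Q : X → X), 1 ∈ A ∧ A ⊆ D ∧ 0 < η ∧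
      (∀ x, dist (Q x) u ≤ e) ∧
      ∀ (y : X) (T : Finset G) (w : G → X),
        (∀ s ∈ T, ∀ s' ∈ T, s ≠ s' → s' * s⁻¹ ∉ D) →
        (∀ s ∈ T, ∀ g ∈ K, dist (g • w s) (g • s • y) ≤ η) →
        ∃ z : X, (∀ g : G, (∀ s ∈ T, g * s⁻¹ ∉ A) → dist (g • z) (g • y) ≤ e) ∧
          ∀ s ∈ T, ∀ h ∈ A, dist ((h * s) • z) (h • Q (w s)) ≤ e := by
  classical
  obtain ⟨δ, hδ, F, hF, hF1, hMF⟩ := hM (e / 2) (half_pos he)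
  -- On the collar, `x` is compared with `y` through `Q (w s)` and `w s`: three errors `η` must fit
  -- into `δ`. Inside, `η` from gluing and `e / 2` from the Markov property add up to at most `e`.
  obtain ⟨η, hη, hηδ, hηe⟩ : ∃ η : ℝ, 0 < η ∧ 3 * η ≤ δ ∧ η ≤ e / 2 :=
    ⟨min (δ / 3) (e / 2), by positivity, by linarith [min_le_left (δ / 3) (e / 2)],
      min_le_right _ _⟩
  obtain ⟨A, hA, hAinv, hA1, hWA⟩ := hW η hη
  have hK : (F * A).Finite := hF.mul hA
  have hAK : A ⊆ F * A := fun h hh => ⟨1, hF1, h, hh, one_mul h⟩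
  -- `Q x` is near `u` at the identity and follows `x` on the collar `FA \ A`. Weak specification
  -- applies because `A` is symmetric, so removing `A` keeps `A * (FA \ A)` away from `1`.
  have hQ : ∀ x : X, ∃ q : X, dist q u ≤ η ∧ ∀ g ∈ (F * A) \ A, dist (g • q) (g • x) ≤ η := by
    intro x
    obtain ⟨z, hz⟩ := hWA 2 ![{1}, (F * A) \ A]
      (by
        intro i
        fin_cases i
        · exact Set.finite_singleton 1
        · exact hK.subset Set.sdiff_subset)
      (by
        intro i j hij
        fin_cases i <;> fin_cases j
        · exact absurd rfl hij
        · ext g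
          simp
        · ext g
          simp only [Set.mem_inter_iff, Set.mem_empty_iff_false, iff_false, not_and]
          rintro ⟨a, ha, k, hk, rfl⟩ h1
          have h1 : a * k = 1 := h1
          apply hk.2
          rw [← hAinv, eq_inv_of_mul_eq_one_right h1]
          simpa using ha
        · exact absurd rfl hij)
      ![u, x]
    refine ⟨z, ?_, fun g hg => hz 1 g hg⟩
    simpa using hz 0 1 rfl
  choose Q hQu hQx using hQ
  -- The first set is what makes the windows `FAs`, `s ∈ T`, separated in the sense of weak
  -- specification. `A` is added only to get `A ⊆ D`.
  have hD : ((F * A)⁻¹ * A * (F * A) ∪ A).Finite := ((hK.inv.mul hA).mul hK).union hA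
  refine ⟨hA.toFinset, hD.toFinset, hK.toFinset, η, Q, by simpa using hA1, ?_, hη,
    fun x => (hQu x).trans (by linarith), fun y T w hT hw => ?_⟩
  · intro a ha
    simp only [Set.Finite.mem_toFinset] at ha ⊢
    exact Or.inr ha
  simp only [Set.Finite.mem_toFinset] at hT hw ⊢
  obtain ⟨x, hx⟩ := hWA T.card (fun i => (fun k => k * (T.equivFin.symm i : G)) '' (F * A))
    (fun i => hK.image _)
    (by
      intro i j hij
      ext g
      simp only [Set.mem_inter_iff, Set.mem_empty_iff_false, iff_false, not_and]
      rintro ⟨a, ha, _, ⟨k, hk, rfl⟩, rfl⟩ ⟨k', hk', h⟩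
      refine hT _ (T.equivFin.symm i).2 _ (T.equivFin.symm j).2
        (fun h => hij (T.equivFin.symm.injective (Subtype.ext h))) (Or.inl ?_)
      refine ⟨k'⁻¹ * a, ⟨k'⁻¹, Set.inv_mem_inv.2 hk', a, ha, rfl⟩, k, hk, ?_⟩
      simp only at h ⊢
      rw [eq_mul_inv_iff_mul_eq, mul_assoc, mul_assoc, ← h, inv_mul_cancel_left])
    (fun i => (T.equivFin.symm i : G)⁻¹ • Q (w (T.equivFin.symm i)))
  have hx' : ∀ s ∈ T, ∀ k ∈ F * A, dist ((k * s) • x) (k • Q (w s)) ≤ η := by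
    intro s hs k hk
    have := hx (T.equivFin ⟨s, hs⟩) (k * s) ⟨k, hk, by simp⟩
    simpa [mul_smul] using this
  -- Only the collar of `AT` has to match: there `x` follows the patches, hence `y`.
  obtain ⟨z, hz, hz'⟩ := hMF (A * (T : Set G)) (hA.mul T.finite_toSet) x y (by
    rintro _ ⟨⟨f, hf, _, ⟨a, ha, s, hs, rfl⟩, rfl⟩, hn⟩
    have hs : s ∈ T := hs
    have hk : f * a ∈ F * A := ⟨f, hf, a, ha, rfl⟩
    have hka : f * a ∉ A := fun h => hn ⟨f * a, h, s, hs, mul_assoc _ _ _⟩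
    have h1 := hx' s hs _ hk
    have h2 := hQx (w s) _ ⟨hk, hka⟩
    have h3 := hw s hs _ hk
    have h4 : (f * a) • s • y = (f * (a * s)) • y := by rw [smul_smul, mul_assoc]
    rw [h4] at h3
    rw [mul_assoc] at h1
    have := dist_triangle4 ((f * (a * s)) • x) ((f * a) • Q (w s)) ((f * a) • w s)
      ((f * (a * s)) • y)
    simp only at *
    linarith)
  refine ⟨z, fun g hg => ?_, fun s hs h hh => ?_⟩
  · refine (hz' g ?_).trans (by linarith)
    rintro ⟨a, ha, s, hs, rfl⟩
    exact hg s hs (by simpa using ha)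
  · have h1 := hz (h * s) ⟨1, hF1, h * s, ⟨h, hh, s, hs, rfl⟩, one_mul _⟩
    have h2 := hx' s hs h (hAK hh)
    have := dist_triangle ((h * s) • z) ((h * s) • x) (h • Q (w s))
    linarith

end Surgery

/-! ### Local conditions on a sofic model. -/

section LocalModels

variable {G X α : Type*} [Group G]

/-- Around `a`, the maps `σ` look like the left translation action of `G` on the window `V`. -/
def IsLocallyRegular (σ : G → Equiv.Perm α) (V : Finset G) (a : α) : Prop :=
  (∀ s ∈ V, ∀ t ∈ V, σ s (σ t a) = σ (s * t) a) ∧ ∀ s ∈ V, ∀ t ∈ V, s ≠ t → σ s a ≠ σ t a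

/-- At `a`, the map `ψ` is equivariant up to `τ` for the elements of `V`. -/
def TracksAt [MetricSpace X] [MulAction G X] (σ : G → Equiv.Perm α) (V : Finset G) (τ : ℝ)
    (ψ : α → X) (a : α) : Prop :=
  ∀ s ∈ V, dist (ψ (σ s a)) (s • ψ a) < τ

/-- No element of `D` moves a point of `C` to another point of `C`. -/
def IsSpread (σ : G → Equiv.Perm α) (D : Finset G) (C : Finset α) : Prop :=
  ∀ v ∈ C, ∀ v' ∈ C, v ≠ v' → ∀ g ∈ D, σ g v ≠ v'

end LocalModels

/-! ### Uniform constants from compactness, and surgery on sofic models. -/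

section Compactness

variable {G X : Type*} [Group G] [MetricSpace X] [CompactSpace X] [MulAction G X]
  [ContinuousConstSMul G X]

/-- The pairs at distance at least `ε` form a compact set, covered by the open conditions that
expansivity gives for the distinct points `f x`, `f y`. Used with `f = id` and with the endomorphism
itself. -/
theorem exists_finset_separating {c : ℝ}
    (hE : ∀ x y : X, x ≠ y → ∃ g : G, c < dist (g • x) (g • y)) {f : X → X} (hf : Continuous f)
    (hinj : Function.Injective f) {ε : ℝ} (hε : 0 < ε) :
    ∃ E : Finset G, ∀ x y, ε ≤ dist x y → ∃ g ∈ E, c < dist (g • f x) (g • f y) := by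
  have hK : IsCompact {p : X × X | ε ≤ dist p.1 p.2} :=
    (isClosed_le continuous_const (continuous_fst.dist continuous_snd)).isCompact
  obtain ⟨E, hE'⟩ := hK.elim_finite_subcover
    (fun g : G => {p : X × X | c < dist (g • f p.1) (g • f p.2)})
    (fun g => isOpen_lt continuous_const
      (((hf.comp continuous_fst).const_smul g).dist ((hf.comp continuous_snd).const_smul g)))
    (by
      rintro ⟨x, y⟩ hxy
      have hne : x ≠ y := by
        rintro rfl
        have : ε ≤ dist x x := hxy
        rw [dist_self] at this
        linarith
      obtain ⟨g, hg⟩ := hE _ _ (hinj.ne hne)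
      exact Set.mem_iUnion.2 ⟨g, hg⟩)
  refine ⟨E, fun x y hxy => ?_⟩
  have h : (x, y) ∈ {p : X × X | ε ≤ dist p.1 p.2} := hxy
  simpa using hE' h

theorem exists_modulus_smul (K : Finset G) {η : ℝ} (hη : 0 < η) :
    ∃ τ : ℝ, 0 < τ ∧ ∀ x y : X, dist x y < τ → ∀ g ∈ K, dist (g • x) (g • y) ≤ η := by
  classical
  induction K using Finset.induction_on with
  | empty => exact ⟨1, one_pos, by simp⟩
  | insert g K _ ih =>
    obtain ⟨τ, hτ, h⟩ := ih
    obtain ⟨τ', hτ', h'⟩ := Metric.uniformContinuous_iff.1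
      (CompactSpace.uniformContinuous_of_continuous (continuous_const_smul (T := X) g)) η hη
    refine ⟨min τ τ', lt_min hτ hτ', fun x y hxy k hk => ?_⟩
    rcases Finset.mem_insert.1 hk with rfl | hk
    · exact (h' (hxy.trans_le (min_le_right _ _))).le
    · exact h x y (hxy.trans_le (min_le_left _ _)) k hk

/-- Modification of an approximately equivariant map `ψ : α → X` near a spread set `S`. -/
theorem exists_sofic_surgery {c : ℝ}
    (hE : ∀ x y : X, x ≠ y → ∃ g : G, c < dist (g • x) (g • y))
    (hW : ∀ ε : ℝ, 0 < ε → ∃ F : Set G, F.Finite ∧ F⁻¹ = F ∧ 1 ∈ F ∧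
      ∀ (n : ℕ) (Ω : Fin n → Set G), (∀ i, (Ω i).Finite) →
        (∀ i j, i ≠ j → (F * Ω i) ∩ Ω j = ∅) →
        ∀ x : Fin n → X, ∃ z : X, ∀ i, ∀ s ∈ Ω i, dist (s • z) (s • x i) ≤ ε)
    (hM : ∀ ε : ℝ, 0 < ε → ∃ δ : ℝ, 0 < δ ∧ ∃ F : Set G, F.Finite ∧ 1 ∈ F ∧
      ∀ (A : Set G), A.Finite → ∀ x y : X,
        (∀ s ∈ (F * A) \ A, dist (s • x) (s • y) ≤ δ) →
        ∃ z : X, (∀ s ∈ F * A, dist (s • z) (s • x) ≤ ε) ∧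
          (∀ s ∈ Aᶜ, dist (s • z) (s • y) ≤ ε))
    (u : X) {e : ℝ} (he : 0 < e) (hec : 3 * e ≤ c) :
    ∃ A D : Finset G, A ⊆ D ∧ ∀ (F : Finset G) (δ : ℝ), 0 < δ →
      ∃ (V : Finset G) (τ : ℝ), 0 < τ ∧ ∀ {α : Type} (σ : G → Equiv.Perm α) (ψ : α → X)
        (R : Set α) (S : Finset α), (∀ a ∈ R, IsLocallyRegular σ V a) →
        (∀ a ∈ R, TracksAt σ V τ ψ a) → IsSpread σ D S →
        ∃ ψ' : α → X,
          (∀ a ∈ R, ∀ t ∈ F, σ t a ∈ R → dist (ψ' (σ t a)) (t • ψ' a) < δ) ∧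
          (∀ v ∈ R, v ∈ S → dist (ψ' v) u ≤ 2 * e) ∧
          (∀ a ∈ R, (∀ h ∈ A, ∀ v ∈ S, σ h v ≠ a) → dist (ψ' a) (ψ a) ≤ e) := by
  classical
  obtain ⟨A, D, K, η, Q, hA1, hAD, hη, hQ, hz⟩ := exists_local_surgery hW hM u he
  refine ⟨A, D, hAD, fun F δ hδ => ?_⟩
  obtain ⟨E, hEsep⟩ := exists_finset_separating hE continuous_id Function.injective_id hδ
  obtain ⟨τ, hτ, hmod⟩ := exists_modulus_smul (X := X) (K ∪ E) (lt_min hη he)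
  -- Tests by `g ∈ E` at `σ t a` and by `g * t` at `a` see only centres `s` in `A⁻¹E` and `A⁻¹EF`.
  -- The element `1` is there for centres at `a` itself.
  set W : Finset G := insert 1 (A⁻¹ * E ∪ A⁻¹ * E * F) with hWdef
  refine ⟨W ∪ A ∪ D ∪ F, τ, hτ, fun {α} σ ψ R S hreg htr hS => ?_⟩
  have hWV : ∀ s ∈ W, s ∈ W ∪ A ∪ D ∪ F := fun s hs => by simp [hs]
  have hAV : ∀ s ∈ A, s ∈ W ∪ A ∪ D ∪ F := fun s hs => by simp [hs]
  have hDV : ∀ s ∈ D, s ∈ W ∪ A ∪ D ∪ F := fun s hs => by simp [hs]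
  have hFV : ∀ s ∈ F, s ∈ W ∪ A ∪ D ∪ F := fun s hs => by simp [hs]
  have h1W : (1 : G) ∈ W := Finset.mem_insert_self _ _
  generalize W ∪ A ∪ D ∪ F = V at *
  have hone : ∀ a ∈ R, σ 1 a = a := fun a ha => by
    have := (hreg a ha).1 1 (hWV 1 h1W) 1 (hWV 1 h1W)
    rw [one_mul] at this
    exact (σ 1).injective this
  set T : α → Finset G := fun a => {s ∈ W | σ s a ∈ S} with hT
  have hTmem : ∀ a s, s ∈ T a ↔ s ∈ W ∧ σ s a ∈ S := fun a s => Finset.mem_filter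
  have key : ∀ a, ∃ z : X, a ∈ R →
      (∀ g : G, (∀ s ∈ T a, g * s⁻¹ ∉ A) → dist (g • z) (g • ψ a) ≤ e) ∧
        ∀ s ∈ T a, ∀ h ∈ A, dist ((h * s) • z) (h • Q (ψ (σ s a))) ≤ e := by
    intro a
    by_cases ha : a ∈ R
    · obtain ⟨z, hz⟩ := hz (ψ a) (T a) (fun s => ψ (σ s a))
        (by
          intro s hs s' hs' hne hD
          rw [hTmem] at hs hs'
          refine hS _ hs.2 _ hs'.2 ((hreg a ha).2 s (hWV s hs.1) s' (hWV s' hs'.1) hne) _ hD ?_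
          rw [(hreg a ha).1 _ (hDV _ hD) s (hWV s hs.1), inv_mul_cancel_right])
        (fun s hs g hg => (hmod _ _ (htr a ha s (hWV s ((hTmem a s).1 hs).1)) g
          (Finset.mem_union_left _ hg)).trans (min_le_left _ _))
      exact ⟨z, fun _ => hz⟩
    · exact ⟨u, fun h => absurd h ha⟩
  choose ψ' hψ' using key
  refine ⟨ψ', fun a ha t ht hb => ?_, fun v hv hvS => ?_, fun a ha hfar => ?_⟩
  -- A failure of equivariance is detected at some `g ∈ E` with error above `c ≥ 3e`. Near a centre
  -- both points are `e`-close to one common patch (total `2e`). Away from all centres both follow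
  -- `ψ`, which is equivariant up to `e` there (total `3e`).
  · by_contra hcon
    obtain ⟨g, hg, hlt⟩ := hEsep _ _ (not_lt.1 hcon)
    simp only [id_eq, smul_smul] at hlt
    have hnear : ∀ s ∈ T a, g * t * s⁻¹ ∈ A → False := by
      intro s hs hA
      have hs' := (hTmem a s).1 hs
      have hW' : s * t⁻¹ ∈ W := by
        refine Finset.mem_insert_of_mem (Finset.mem_union_left _ ?_)
        refine Finset.mem_mul.2 ⟨(g * t * s⁻¹)⁻¹, Finset.inv_mem_inv hA, g, hg, ?_⟩
        group
      have hσ : σ (s * t⁻¹) (σ t a) = σ s a := by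
        rw [(hreg a ha).1 _ (hWV _ hW') t (hFV t ht), inv_mul_cancel_right]
      have h1 := (hψ' a ha).2 s hs _ hA
      have h2 := (hψ' _ hb).2 (s * t⁻¹) ((hTmem _ _).2 ⟨hW', hσ ▸ hs'.2⟩) _ hA
      rw [hσ, show g * t * s⁻¹ * (s * t⁻¹) = g by group] at h2
      rw [inv_mul_cancel_right] at h1
      have := dist_triangle_right (g • ψ' (σ t a)) ((g * t) • ψ' a)
        ((g * t * s⁻¹) • Q (ψ (σ s a)))
      linarith
    have hnear' : ∀ s ∈ T (σ t a), g * s⁻¹ ∈ A → False := by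
      intro s hs hA
      have hs' := (hTmem _ s).1 hs
      have hW' : s * t ∈ W := by
        refine Finset.mem_insert_of_mem (Finset.mem_union_right _ ?_)
        refine Finset.mem_mul.2 ⟨s, Finset.mem_mul.2
          ⟨(g * s⁻¹)⁻¹, Finset.inv_mem_inv hA, g, hg, by group⟩, t, ht, rfl⟩
      refine hnear (s * t) ((hTmem _ _).2 ⟨hW', ?_⟩) ?_
      · rw [← (hreg a ha).1 s (hWV s hs'.1) t (hFV t ht)]
        exact hs'.2
      · rwa [show g * t * (s * t)⁻¹ = g * s⁻¹ by group]
    have h1 := (hψ' a ha).1 (g * t) hnear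
    have h2 := (hψ' _ hb).1 g hnear'
    have h3 := (hmod _ _ (htr a ha t (hFV t ht)) g (Finset.mem_union_right _ hg)).trans
      (min_le_right _ _)
    rw [smul_smul] at h3
    have := dist_triangle4_right (g • ψ' (σ t a)) ((g * t) • ψ' a) (g • ψ (σ t a))
      ((g * t) • ψ a)
    linarith
  · have h := (hψ' v hv).2 1 ((hTmem v 1).2 ⟨h1W, by rwa [hone v hv]⟩) 1 hA1
    simp only [one_mul, one_smul] at h
    have := dist_triangle (ψ' v) (Q (ψ (σ 1 v))) u
    have := hQ (ψ (σ 1 v))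
    linarith
  · have h := (hψ' a ha).1 1 (fun s hs hA => by
      rw [one_mul] at hA
      have hs' := (hTmem a s).1 hs
      refine hfar _ hA _ hs'.2 ?_
      rw [(hreg a ha).1 _ (hAV _ hA) s (hWV s hs'.1), inv_mul_cancel, hone a ha])
    simpa using h

end Compactness

/-! ### Combinatorial counting. -/

section Counting

theorem card_filter_le_card_filter {α : Type*} [Fintype α] {p q : α → Prop}
    {_ : DecidablePred p} {_ : DecidablePred q} (h : ∀ a, p a → q a) :
    ((Finset.univ.filter p).card : ℝ) ≤ (Finset.univ.filter q).card :=
  Nat.cast_le.2 (Finset.card_le_card fun a ha =>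
    Finset.mem_filter.2 ⟨Finset.mem_univ _, h a (Finset.mem_filter.1 ha).2⟩)

-- For a spread `C` of maximal cardinality, each point of `R` lies in `C` or is joined to it by some
-- `σ g` or its inverse with `g ∈ D`; hence the factor `2 |D| + 1`.
open Classical in
theorem exists_isSpread_subset {G α : Type*} [Group G] (σ : G → Equiv.Perm α) (D : Finset G)
    (R : Finset α) :
    ∃ C ⊆ R, IsSpread σ D C ∧ R.card ≤ C.card * (2 * D.card + 1) := by
  obtain ⟨C, hC, hmax⟩ := Finset.exists_max_image (R.powerset.filter fun C => IsSpread σ D C)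
    Finset.card ⟨∅, Finset.mem_filter.2 ⟨by simp, fun v hv => by simp at hv⟩⟩
  rw [Finset.mem_filter, Finset.mem_powerset] at hC
  refine ⟨C, hC.1, hC.2, ?_⟩
  have hsub : R ⊆ C.biUnion fun v =>
      insert v (D.image (fun g => σ g v) ∪ D.image (fun g => (σ g).symm v)) := by
    intro a ha
    by_contra hn
    simp only [Finset.mem_biUnion, Finset.mem_insert, Finset.mem_union, Finset.mem_image,
      not_exists, not_and, not_or] at hn
    have haC : a ∉ C := fun h => (hn a h).1 rfl
    have hmem : insert a C ∈ R.powerset.filter fun C => IsSpread σ D C := by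
      rw [Finset.mem_filter, Finset.mem_powerset]
      refine ⟨Finset.insert_subset ha hC.1, fun v hv v' hv' hne g hg h => ?_⟩
      rcases Finset.mem_insert.1 hv with rfl | hvC <;>
        rcases Finset.mem_insert.1 hv' with rfl | hvC'
      · exact hne rfl
      · exact (hn v' hvC').2.2 g hg (by rw [← h, Equiv.symm_apply_apply])
      · exact (hn v hvC).2.1 g hg h
      · exact hC.2 v hvC v' hvC' hne g hg h
    have := hmax _ hmem
    rw [Finset.card_insert_of_notMem haC] at this
    omega
  refine (Finset.card_le_card hsub).trans (Finset.card_biUnion_le_card_mul _ _ _ fun v _ => ?_)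
  refine (Finset.card_insert_le _ _).trans (Nat.succ_le_succ ?_)
  refine (Finset.card_union_le _ _).trans ?_
  have h1 := Finset.card_image_le (s := D) (f := fun g => σ g v)
  have h2 := Finset.card_image_le (s := D) (f := fun g => (σ g).symm v)
  omega

open Classical in
theorem exists_large_fiber {ι κ : Type*} (Z : Finset ι) (g : ι → κ) (t : Finset κ)
    (hg : ∀ z ∈ Z, g z ∈ t) :
    ∃ P ⊆ Z, (Z.card : ℝ) ≤ t.card * P.card ∧ ∀ x ∈ P, ∀ y ∈ P, g x = g y := by
  rcases t.eq_empty_or_nonempty with rfl | ht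
  · refine ⟨∅, Finset.empty_subset _, ?_, by simp⟩
    rw [Finset.eq_empty_of_forall_notMem fun z hz => Finset.notMem_empty _ (hg z hz)]
    simp
  · have ht' : (0 : ℝ) < t.card := by exact_mod_cast ht.card_pos
    obtain ⟨b, -, hb⟩ := Finset.exists_le_card_fiber_of_nsmul_le_card_of_maps_to
      (b := (Z.card : ℝ) / t.card) hg ht (by rw [nsmul_eq_mul, mul_div_cancel₀ _ ht'.ne'])
    rw [div_le_iff₀' ht'] at hb
    exact ⟨_, Finset.filter_subset _ _, hb, fun x hx y hy =>
      (Finset.mem_filter.1 hx).2.trans (Finset.mem_filter.1 hy).2.symm⟩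

theorem sum_powerset_pow {α : Type*} (C : Finset α) (k : ℝ) :
    ∑ S ∈ C.powerset, k ^ S.card = (1 + k) ^ C.card := by
  have := Finset.sum_pow_mul_eq_add_pow k 1 C
  rw [add_comm k] at this
  simpa using this

open Classical in
theorem card_exists_le {ι α : Type*} [Fintype α] (I : Finset ι) (P : ι → α → Prop) {m : ℝ}
    (h : ∀ i ∈ I, ((Finset.univ.filter (P i)).card : ℝ) ≤ m) :
    ((Finset.univ.filter fun a => ∃ i ∈ I, P i a).card : ℝ) ≤ I.card * m := by
  have hsub : (Finset.univ.filter fun a => ∃ i ∈ I, P i a) ⊆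
      I.biUnion fun i => Finset.univ.filter (P i) := by
    intro a ha
    simpa using ha
  calc ((Finset.univ.filter fun a => ∃ i ∈ I, P i a).card : ℝ)
      ≤ ∑ i ∈ I, ((Finset.univ.filter (P i)).card : ℝ) := by
        exact_mod_cast (Finset.card_le_card hsub).trans Finset.card_biUnion_le
    _ ≤ I.card * m := by
        rw [← nsmul_eq_mul]
        exact Finset.sum_le_card_nsmul _ _ _ h

/-- There are at most `exp (γ d)` partial maps `[d] → [M]` whose domain has small density. -/
theorem exists_card_sparse_le (M : ℕ) {γ : ℝ} (hγ : 0 < γ) :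
    ∃ θ : ℝ, 0 < θ ∧ ∀ d : ℕ,
      ((Finset.univ.filter fun p : Fin d → Option (Fin M) =>
        ((Finset.univ.filter fun a => (p a).isSome).card : ℝ) ≤ θ * d).card : ℝ) ≤
        Real.exp (γ * d) := by
  -- Chernoff bound: weight a partial map by `x` to the size of its domain. The total weight is `(1
  -- + Mx) ^ d`, and a sparse map weighs at least `x ^ (θ d)`. Each of the two exponents costs at
  -- most `γ / 2`.
  obtain ⟨x, hx0, hx1, hxM⟩ : ∃ x : ℝ, 0 < x ∧ x ≤ 1 ∧ M * x ≤ γ / 2 := by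
    refine ⟨min 1 (γ / 2 / (M + 1)), by positivity, min_le_left _ _, ?_⟩
    calc (M : ℝ) * min 1 (γ / 2 / (M + 1)) ≤ (M + 1) * (γ / 2 / (M + 1)) := by
          gcongr
          · linarith
          · exact min_le_right _ _
      _ = γ / 2 := by field_simp
  have hlog : Real.log x ≤ 0 := Real.log_nonpos hx0.le hx1
  refine ⟨γ / 2 / (1 - Real.log x), div_pos (half_pos hγ) (by linarith), fun d => ?_⟩
  set θ := γ / 2 / (1 - Real.log x) with hθ
  have hθ0 : 0 < θ := div_pos (half_pos hγ) (by linarith)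
  have hθx : -(θ * Real.log x) ≤ γ / 2 := by
    have : θ * (1 - Real.log x) = γ / 2 := by rw [hθ]; field_simp [show 1 - Real.log x ≠ 0 by linarith]
    nlinarith
  set s := Finset.univ.filter fun p : Fin d → Option (Fin M) =>
        ((Finset.univ.filter fun a => (p a).isSome).card : ℝ) ≤ θ * d with hs
  have hsum : ∑ p : Fin d → Option (Fin M), ∏ a, (if (p a).isSome then x else 1) =
      (1 + M * x) ^ d := by
    have := Finset.prod_univ_sum (fun _ : Fin d => (Finset.univ : Finset (Option (Fin M))))
      (fun _ o => if o.isSome then x else (1 : ℝ))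
    rw [Fintype.piFinset_univ] at this
    rw [← this]
    simp [Fintype.sum_option]
  have hterm : ∀ p ∈ s, Real.exp (θ * Real.log x * d) ≤
      ∏ a, (if (p a).isSome then x else 1) := by
    intro p hp
    have hp' := (Finset.mem_filter.1 hp).2
    rw [Finset.prod_ite, Finset.prod_const, Finset.prod_const_one, mul_one,
      ← Real.exp_log (pow_pos hx0 _), Real.log_pow]
    apply Real.exp_le_exp.2
    nlinarith
  have h1 : s.card * Real.exp (θ * Real.log x * d) ≤ (1 + M * x) ^ d := by
    rw [← hsum, ← nsmul_eq_mul]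
    refine (Finset.card_nsmul_le_sum _ _ _ hterm).trans ?_
    refine Finset.sum_le_sum_of_subset_of_nonneg (Finset.subset_univ _) fun p _ _ => ?_
    exact Finset.prod_nonneg fun a _ => by split_ifs <;> linarith
  have h2 : (1 + M * x) ^ d ≤ Real.exp (M * x * d) := by
    rw [mul_comm (M * x : ℝ) d, Real.exp_nat_mul]
    have := Real.add_one_le_exp (M * x : ℝ)
    gcongr
    linarith
  calc (s.card : ℝ) = s.card * Real.exp (θ * Real.log x * d) *
        Real.exp (-(θ * Real.log x * d)) := by
        rw [mul_assoc, ← Real.exp_add]; simp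
    _ ≤ Real.exp (M * x * d) * Real.exp (-(θ * Real.log x * d)) := by
        gcongr
        exact h1.trans h2
    _ = Real.exp ((M * x + -(θ * Real.log x)) * d) := by
        rw [← Real.exp_add]; ring_nf
    _ ≤ Real.exp (γ * d) := by
        gcongr
        linarith

end Counting

/-! ### Density of exceptional points. -/

section SoficEstimates

-- Irregularity at `a` is one of finitely many failures, of multiplicativity or of freeness at a
-- pair in `V × V`, each of vanishing density.
open Classical in
theorem SoficApproximation.eventually_card_not_regular_le {G : Type*} [Group G]
    (S : SoficApproximation G) (V : Finset G) {θ : ℝ} (hθ : 0 < θ) :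
    ∀ᶠ j in atTop, ((Finset.univ.filter fun a => ¬ IsLocallyRegular (S.σ j) V a).card : ℝ) ≤
      θ * S.d j := by
  set κ : ℝ := θ / (2 * ((V ×ˢ V).card + 1)) with hκ
  have hκ0 : 0 < κ := by positivity
  have hmul : ∀ᶠ j in atTop, ∀ p ∈ V ×ˢ V,
      normHamming (S.σ j p.1 * S.σ j p.2) (S.σ j (p.1 * p.2)) < κ :=
    (Filter.eventually_all_finset _).2 fun p _ => (S.tendsto_mul p.1 p.2).eventually_lt_const hκ0
  have hfree : ∀ᶠ j in atTop, ∀ p ∈ V ×ˢ V, p.1 ≠ p.2 →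
      1 - κ < normHamming (S.σ j p.1) (S.σ j p.2) := by
    refine (Filter.eventually_all_finset _).2 fun p _ => ?_
    by_cases h : p.1 = p.2
    · exact Eventually.of_forall fun j hne => absurd h hne
    · filter_upwards [(S.tendsto_free p.1 p.2 h).eventually_const_lt
        (show 1 - κ < 1 by linarith)] with j hj _ using hj
  filter_upwards [hmul, hfree] with j hj hj'
  have hd : (0 : ℝ) < S.d j := by exact_mod_cast S.d_pos j
  have h1 := card_exists_le (V ×ˢ V)
    (fun p a => S.σ j p.1 (S.σ j p.2 a) ≠ S.σ j (p.1 * p.2) a) (m := κ * S.d j)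
    (fun p hp => by
      have := hj p hp
      rw [normHamming, div_lt_iff₀ hd] at this
      exact (card_filter_le_card_filter fun a ha => ha).trans this.le)
  have h2 := card_exists_le (V ×ˢ V)
    (fun p a => p.1 ≠ p.2 ∧ S.σ j p.1 a = S.σ j p.2 a) (m := κ * S.d j)
    (fun p hp => by
      by_cases hne : p.1 = p.2
      · simp only [hne, ne_eq, not_true_eq_false, false_and, Finset.filter_false,
          Finset.card_empty, Nat.cast_zero]
        positivity
      · have := hj' p hp hne
        rw [normHamming, lt_div_iff₀ hd] at this
        unfold hammingDist at this
        have hc := Finset.card_filter_add_card_filter_not (s := (Finset.univ : Finset (Fin (S.d j))))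
          (fun a => S.σ j p.1 a = S.σ j p.2 a)
        rw [Finset.card_univ, Fintype.card_fin] at hc
        have hc' : ((Finset.univ.filter fun a => S.σ j p.1 a = S.σ j p.2 a).card : ℝ) +
          (Finset.univ.filter fun a => ¬ S.σ j p.1 a = S.σ j p.2 a).card = S.d j := by
          exact_mod_cast hc
        have he : ((Finset.univ.filter fun i => S.σ j p.1 i ≠ S.σ j p.2 i).card : ℝ) =
            (Finset.univ.filter fun a => ¬ S.σ j p.1 a = S.σ j p.2 a).card := by
          congr!
        refine le_trans (card_filter_le_card_filter fun a ha => ha.2)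
          (show ((Finset.univ.filter fun a => S.σ j p.1 a = S.σ j p.2 a).card : ℝ) ≤ _ from ?_)
        linarith)
  have hsub : (Finset.univ.filter fun a => ¬ IsLocallyRegular (S.σ j) V a) ⊆
      (Finset.univ.filter fun a => ∃ p ∈ V ×ˢ V,
        S.σ j p.1 (S.σ j p.2 a) ≠ S.σ j (p.1 * p.2) a) ∪
      (Finset.univ.filter fun a => ∃ p ∈ V ×ˢ V, p.1 ≠ p.2 ∧ S.σ j p.1 a = S.σ j p.2 a) := by
    intro a ha
    by_contra hn
    simp only [Finset.mem_union, Finset.mem_filter, Finset.mem_univ, true_and, not_or, not_exists,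
      not_and, Finset.mem_product, Prod.forall, not_not] at hn
    exact (Finset.mem_filter.1 ha).2 ⟨fun s hs t ht => hn.1 s t ⟨hs, ht⟩,
      fun s hs t ht => hn.2 s t ⟨hs, ht⟩⟩
  have h3 : ((Finset.univ.filter fun a => ¬ IsLocallyRegular (S.σ j) V a).card : ℝ) ≤
      (V ×ˢ V).card * (κ * S.d j) + (V ×ˢ V).card * (κ * S.d j) :=
    le_trans (by exact_mod_cast (Finset.card_le_card hsub).trans (Finset.card_union_le _ _))
      (add_le_add h1 h2)
  refine h3.trans ?_
  have h4 : κ * (2 * ((V ×ˢ V).card + 1)) = θ := by rw [hκ]; field_simp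
  rw [← h4]
  have : 0 < κ * S.d j := by positivity
  linarith

variable {G X : Type*} [Group G] [ρ : MetricSpace X] [MulAction G X]

-- Chebyshev's inequality: a small `ρ₂` error is a small pointwise error off few points.
open Classical in
theorem card_le_of_mem_soficMap {d : ℕ} {σ : G → Equiv.Perm (Fin d)} {F : Finset G} {δ : ℝ}
    {φ : Fin d → X} (hφ : φ ∈ soficMap ρ F δ σ) {s : G} (hs : s ∈ F) {τ : ℝ} (hτ : 0 < τ) :
    ((Finset.univ.filter fun a => τ ≤ dist (φ (σ s a)) (s • φ a)).card : ℝ) ≤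
      (δ / τ) ^ 2 * d := by
  rcases Nat.eq_zero_or_pos d with rfl | hd
  · simp
  have hd' : (0 : ℝ) < d := by exact_mod_cast hd
  have h := hφ s hs
  have hδ : 0 < δ := lt_of_le_of_lt (Real.sqrt_nonneg _) h
  rw [rhoTwo, Real.sqrt_lt' hδ, one_div, inv_mul_lt_iff₀ hd'] at h
  have h1 : ((Finset.univ.filter fun a => τ ≤ dist (φ (σ s a)) (s • φ a)).card : ℝ) * τ ^ 2 ≤
      ∑ a, (dist (φ (σ s a)) (s • φ a)) ^ 2 := by
    rw [← nsmul_eq_mul]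
    refine (Finset.card_nsmul_le_sum _ (fun a => (dist (φ (σ s a)) (s • φ a)) ^ 2) _
      fun a ha => ?_).trans
      (Finset.sum_le_sum_of_subset_of_nonneg (Finset.subset_univ _) fun a _ _ => sq_nonneg _)
    have := (Finset.mem_filter.1 ha).2
    gcongr
  rw [div_pow, div_mul_eq_mul_div, le_div_iff₀ (by positivity), mul_comm (δ ^ 2)]
  exact h1.trans h.le

/-- Converse to the Chebyshev bound. The error can be large, at most `Δ`, only if `a` or `σ t a`
lies in `B`; as `σ t` is a permutation, this costs twice the density of `B`. -/
theorem mem_soficMap_of_small_exception {d : ℕ} (hd : 0 < d) {σ : G → Equiv.Perm (Fin d)}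
    {F : Finset G} {δ δ' θ Δ : ℝ} (hδ : 0 < δ) (hΔ : ∀ x y : X, dist x y ≤ Δ)
    (hsmall : δ' ^ 2 + 2 * θ * Δ ^ 2 < δ ^ 2) {ψ : Fin d → X} {B : Finset (Fin d)}
    (hB : (B.card : ℝ) ≤ θ * d)
    (h : ∀ a ∉ B, ∀ t ∈ F, σ t a ∉ B → dist (ψ (σ t a)) (t • ψ a) < δ') :
    ψ ∈ soficMap ρ F δ σ := by
  classical
  intro t ht
  have hd' : (0 : ℝ) < d := by exact_mod_cast hd
  rw [rhoTwo, Real.sqrt_lt' hδ, one_div, inv_mul_lt_iff₀ hd']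
  have hle : ∀ a, (dist (ψ (σ t a)) (t • ψ a)) ^ 2 ≤
      δ' ^ 2 + ((if a ∈ B then Δ ^ 2 else 0) + if σ t a ∈ B then Δ ^ 2 else 0) := by
    intro a
    have h0 : 0 ≤ dist (ψ (σ t a)) (t • ψ a) := dist_nonneg
    have h1 : (dist (ψ (σ t a)) (t • ψ a)) ^ 2 ≤ Δ ^ 2 := by
      gcongr
      exact hΔ _ _
    have h2 := sq_nonneg δ'
    have h3 := sq_nonneg Δ
    split_ifs with ha hb hb
    · linarith
    · linarith
    · linarith
    · have := h a ha t ht hb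
      have : (dist (ψ (σ t a)) (t • ψ a)) ^ 2 ≤ δ' ^ 2 := by gcongr
      linarith
  have hsum : ∑ a : Fin d, (if σ t a ∈ B then Δ ^ 2 else 0) =
      ∑ a : Fin d, (if a ∈ B then Δ ^ 2 else 0) :=
    Equiv.sum_comp (σ t) fun a => if a ∈ B then Δ ^ 2 else 0
  have hB' : ∑ a : Fin d, (if a ∈ B then Δ ^ 2 else 0) = B.card * Δ ^ 2 := by
    rw [← Finset.sum_filter, Finset.sum_const, nsmul_eq_mul]
    simp
  calc ∑ a, (dist ((ψ ∘ σ t) a) (t • ψ a)) ^ 2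
      ≤ ∑ a : Fin d, (δ' ^ 2 +
        ((if a ∈ B then Δ ^ 2 else 0) + if σ t a ∈ B then Δ ^ 2 else 0)) :=
        Finset.sum_le_sum fun a _ => hle a
    _ = d * δ' ^ 2 + 2 * (B.card * Δ ^ 2) := by
        rw [Finset.sum_add_distrib, Finset.sum_add_distrib, hsum, hB']
        simp
        ring
    _ ≤ d * δ' ^ 2 + 2 * (θ * d * Δ ^ 2) := by gcongr
    _ = d * (δ' ^ 2 + 2 * θ * Δ ^ 2) := by ring
    _ < d * δ ^ 2 := by gcongr

end SoficEstimates

/-! ### Finite codes and pigeonhole families. -/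

theorem IsLocallyRegular.mono {G α : Type*} [Group G] {σ : G → Equiv.Perm α} {V V' : Finset G}
    {a : α} (h : IsLocallyRegular σ V a) (hV : V' ⊆ V) : IsLocallyRegular σ V' a :=
  ⟨fun s hs t ht => h.1 s (hV hs) t (hV ht), fun s hs t ht => h.2 s (hV hs) t (hV ht)⟩

theorem TracksAt.mono {G X α : Type*} [Group G] [MetricSpace X] [MulAction G X]
    {σ : G → Equiv.Perm α} {V V' : Finset G} {τ τ' : ℝ} {ψ : α → X} {a : α}
    (h : TracksAt σ V τ ψ a) (hV : V' ⊆ V) (hτ : τ ≤ τ') : TracksAt σ V' τ' ψ a :=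
  fun s hs => (h s (hV hs)).trans_le hτ

/-- Labels the pieces of a finite partition into small sets, so that pigeonhole arguments apply to
`X`-valued maps. -/
theorem exists_finite_code {X : Type*} [MetricSpace X] [CompactSpace X] {r : ℝ} (hr : 0 < r) :
    ∃ (M : ℕ) (code : X → Fin M), ∀ x y, code x = code y → dist x y < r := by
  obtain ⟨t, -, ht, hcov⟩ := (isCompact_univ (X := X)).finite_cover_balls
    (half_pos hr)
  have hmem : ∀ x : X, ∃ y : t, dist x y < r / 2 := fun x => by
    obtain ⟨y, hy, hxy⟩ := Set.mem_iUnion₂.1 (hcov (Set.mem_univ x))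
    exact ⟨⟨y, hy⟩, hxy⟩
  choose g hg using hmem
  have := ht.to_subtype
  refine ⟨Nat.card t, fun x => Finite.equivFin t (g x), fun x y hxy => ?_⟩
  have hxy := (Finite.equivFin t).injective hxy
  have h1 := hg x
  have h2 := hg y
  rw [← hxy] at h2
  have := dist_triangle_right x y (g x : X)
  linarith

/-- Distinct maps in `Z` are at distance at least `ε` at some point. -/
def IsPointwiseSeparated {X α : Type*} [MetricSpace X] (ε : ℝ) (Z : Finset (α → X)) : Prop :=
  ∀ φ ∈ Z, ∀ ψ ∈ Z, φ ≠ ψ → ∃ a, ε ≤ dist (φ a) (ψ a)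

/-- Pigeonhole over the exceptional sets of the maps in `Z` and their codes there. -/
theorem exists_uniform_subfamily {X : Type*} {d M : ℕ} {θ L : ℝ} (code : X → Fin M)
    (hL : ((Finset.univ.filter fun p : Fin d → Option (Fin M) =>
        ((Finset.univ.filter fun a => (p a).isSome).card : ℝ) ≤ θ * d).card : ℝ) ≤ L)
    {Z : Finset (Fin d → X)} (bad : (Fin d → X) → Finset (Fin d))
    (hbad : ∀ φ ∈ Z, ((bad φ).card : ℝ) ≤ θ * d) :
    ∃ P ⊆ Z, (Z.card : ℝ) ≤ L * P.card ∧ ∀ φ ∈ P, ∀ φ' ∈ P,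
      bad φ = bad φ' ∧ ∀ a ∈ bad φ, code (φ a) = code (φ' a) := by
  let p : (Fin d → X) → Fin d → Option (Fin M) :=
    fun φ a => if a ∈ bad φ then some (code (φ a)) else none
  have hsome : ∀ φ a, (p φ a).isSome = true ↔ a ∈ bad φ := fun φ a => by
    by_cases h : a ∈ bad φ <;> simp [p, h]
  have hfil : ∀ φ, (Finset.univ.filter fun a => (p φ a).isSome = true) = bad φ := fun φ => by
    ext a
    rw [Finset.mem_filter, hsome]
    simp
  obtain ⟨P, hPZ, hcard, hP⟩ := exists_large_fiber Z p
    (Finset.univ.filter fun p : Fin d → Option (Fin M) =>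
        ((Finset.univ.filter fun a => (p a).isSome).card : ℝ) ≤ θ * d) (fun φ hφ => by
    rw [Finset.mem_filter, hfil]
    exact ⟨Finset.mem_univ _, hbad φ hφ⟩)
  refine ⟨P, hPZ, hcard.trans (by gcongr), fun φ hφ φ' hφ' => ?_⟩
  have heq := hP φ hφ φ' hφ'
  have hb : bad φ = bad φ' := by rw [← hfil, ← hfil, heq]
  refine ⟨hb, fun a ha => ?_⟩
  have h1 := congrFun heq a
  have ha' := hb ▸ ha
  simpa only [p, if_pos ha, if_pos ha', Option.some.injEq] using h1

/-! ### Enlarging a separated family. -/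

section Amplification

variable {G X : Type*} [Group G] [MetricSpace X] [MulAction G X]

open Classical in
/-- Surgery along all subsets of a spread set turns a separated family of approximately
equivariant maps into an exponentially larger one. -/
theorem exists_larger_separated_family {d M : ℕ} {f : X → X} {u : X} {e τ δ θ L : ℝ}
    (he : 0 < e) (hτ : τ ≤ e) (hθ : 0 ≤ θ) (hu : ∀ x, 8 * e ≤ dist u (f x)) {code : X → Fin M}
    (hcode : ∀ x y, code x = code y → dist x y < 4 * e ∧ dist (f x) (f y) < 6 * e)
    {σ : G → Equiv.Perm (Fin d)} {A D E F V : Finset G} (hAD : A ⊆ D) (hEV : E ⊆ V)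
    (hE : ∀ x y, 4 * e ≤ dist x y → ∃ g ∈ E, 8 * e < dist (g • f x) (g • f y))
    (hsurg : ∀ (ψ : Fin d → X) (R : Set (Fin d)) (S : Finset (Fin d)),
      (∀ a ∈ R, IsLocallyRegular σ V a) → (∀ a ∈ R, TracksAt σ V τ ψ a) → IsSpread σ D S →
        ∃ ψ' : Fin d → X,
          (∀ a ∈ R, ∀ t ∈ F, σ t a ∈ R → dist (ψ' (σ t a)) (t • ψ' a) < δ) ∧
          (∀ v ∈ R, v ∈ S → dist (ψ' v) u ≤ 2 * e) ∧
          (∀ a ∈ R, (∀ h ∈ A, ∀ v ∈ S, σ h v ≠ a) → dist (ψ' a) (ψ a) ≤ e))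
    (hL : ((Finset.univ.filter fun p : Fin d → Option (Fin M) =>
        ((Finset.univ.filter fun a => (p a).isSome).card : ℝ) ≤ θ * d).card : ℝ) ≤ L)
    {Z : Finset (Fin d → X)} (hZ : IsPointwiseSeparated (4 * e) Z)
    (hbad : ∀ φ ∈ Z, ((Finset.univ.filter fun a =>
      ¬ (IsLocallyRegular σ V a ∧ TracksAt σ V τ (f ∘ φ) a)).card : ℝ) ≤ θ * d) :
    ∃ (Z' : Finset (Fin d → X)) (n : ℕ), IsPointwiseSeparated (4 * e) Z' ∧
      (∀ ψ ∈ Z', ∃ B : Finset (Fin d), (B.card : ℝ) ≤ θ * d ∧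
        ∀ a ∉ B, ∀ t ∈ F, σ t a ∉ B → dist (ψ (σ t a)) (t • ψ a) < δ) ∧
      (d : ℝ) - θ * d ≤ n * (2 * D.card + 1) ∧
      (Z.card : ℝ) * (1 + ((M : ℝ) ^ A.card)⁻¹) ^ n ≤ L * Z'.card := by
  rcases Z.eq_empty_or_nonempty with rfl | hZne
  · refine ⟨∅, d, hZ, by simp, ?_, by simp⟩
    have h0 : (0 : ℝ) ≤ d := Nat.cast_nonneg d
    have h1 : 0 ≤ θ * d := mul_nonneg hθ h0
    have h2 : (0 : ℝ) ≤ d * D.card := by positivity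
    linarith
  have hM : (1 : ℝ) ≤ M := by exact_mod_cast (Fin.pos (code u))
  set bad : (Fin d → X) → Finset (Fin d) := fun φ => Finset.univ.filter fun a =>
      ¬ (IsLocallyRegular σ V a ∧ TracksAt σ V τ (f ∘ φ) a) with hbaddef
  -- At the cost of a factor `L`, all maps share one exceptional set `B` and the same codes on it.
  obtain ⟨P₀, hP₀Z, hP₀L, hP₀⟩ := exists_uniform_subfamily code hL bad hbad
  obtain ⟨φ₀, hφ₀⟩ : P₀.Nonempty := by
    rw [← Finset.card_pos]
    by_contra h
    rw [Nat.eq_zero_of_not_pos h, Nat.cast_zero, mul_zero] at hP₀L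
    have : (0 : ℝ) < Z.card := by exact_mod_cast hZne.card_pos
    linarith
  set B := bad φ₀ with hB
  have hbadB : ∀ φ ∈ P₀, bad φ = B := fun φ hφ => (hP₀ φ hφ φ₀ hφ₀).1
  have hcodeB : ∀ φ ∈ P₀, ∀ φ' ∈ P₀, ∀ a ∈ B, code (φ a) = code (φ' a) :=
    fun φ hφ φ' hφ' a ha => (hP₀ φ hφ φ' hφ').2 a (hbadB φ hφ ▸ ha)
  have hgood : ∀ φ ∈ P₀, ∀ a ∉ B, IsLocallyRegular σ V a ∧ TracksAt σ V τ (f ∘ φ) a := by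
    intro φ hφ a ha
    rw [← hbadB φ hφ, hbaddef] at ha
    simpa using ha
  have hBcard : (B.card : ℝ) ≤ θ * d := hbad φ₀ (hP₀Z hφ₀)
  obtain ⟨C, hCB, hC, hCcard⟩ := exists_isSpread_subset σ D Bᶜ
  have hsurg' : ∀ (φ : Fin d → X) (S : Finset (Fin d)), ∃ ψ' : Fin d → X, φ ∈ P₀ → S ⊆ C →
      (∀ a ∉ B, ∀ t ∈ F, σ t a ∉ B → dist (ψ' (σ t a)) (t • ψ' a) < δ) ∧
      (∀ v ∉ B, v ∈ S → dist (ψ' v) u ≤ 2 * e) ∧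
      (∀ a ∉ B, (∀ h ∈ A, ∀ v ∈ S, σ h v ≠ a) → dist (ψ' a) (f (φ a)) ≤ e) := by
    intro φ S
    by_cases h : φ ∈ P₀ ∧ S ⊆ C
    · obtain ⟨ψ', hψ'⟩ := hsurg (f ∘ φ) {a | a ∉ B} S (fun a ha => (hgood φ h.1 a ha).1)
        (fun a ha => (hgood φ h.1 a ha).2)
        (fun v hv v' hv' => hC v (h.2 hv) v' (h.2 hv'))
      exact ⟨ψ', fun _ _ => hψ'⟩
    · exact ⟨φ, fun h1 h2 => absurd ⟨h1, h2⟩ h⟩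
  choose Ψ hΨ using hsurg'
  -- `N S` is the zone disturbed by the surgery. Freezing the codes there means that separation
  -- within `P S` can only be witnessed elsewhere.
  set N : Finset (Fin d) → Finset (Fin d) := fun S => Finset.image₂ (fun h v => σ h v) A S with hN
  have hfib := fun S : Finset (Fin d) => exists_large_fiber P₀
    (fun φ => fun b : N S => code (φ b)) Finset.univ (fun _ _ => Finset.mem_univ _)
  choose P hPsub hPcard hP using hfib
  have hPcard' : ∀ S, (P₀.card : ℝ) * ((M : ℝ) ^ A.card)⁻¹ ^ S.card ≤ (P S).card := by
    intro S
    have h1 := hPcard S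
    rw [Finset.card_univ, Fintype.card_fun, Fintype.card_fin, Fintype.card_coe] at h1
    have h2 : (M : ℝ) ^ (N S).card ≤ ((M : ℝ) ^ A.card) ^ S.card := by
      rw [← pow_mul]
      exact pow_le_pow_right₀ hM (Finset.card_image₂_le _ _ _)
    have h3 : (P₀.card : ℝ) ≤ ((M : ℝ) ^ A.card) ^ S.card * (P S).card := by
      push_cast at h1
      exact h1.trans (by gcongr)
    rwa [inv_pow, mul_inv_le_iff₀' (by positivity)]
  -- At `v` the first map is within `2e` of `u`. The second is within `e` of `f(X)`, because `A ⊆ D`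
  -- and spreadness keep the surgery along `S'` away from `v`. This leaves `8e - 3e ≥ 4e`.
  have hsepS : ∀ φ ∈ P₀, ∀ φ' ∈ P₀, ∀ S ⊆ C, ∀ S' ⊆ C, ∀ v ∈ S, v ∉ S' →
      4 * e ≤ dist (Ψ φ S v) (Ψ φ' S' v) := by
    intro φ hφ φ' hφ' S hS S' hS' v hv hv'
    have hvB : v ∉ B := Finset.mem_compl.1 (hCB (hS hv))
    have h1 := (hΨ φ S hφ hS).2.1 v hvB hv
    have h2 := (hΨ φ' S' hφ' hS').2.2 v hvB fun h hh v' hv'' =>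
      hC v' (hS' hv'') v (hS hv) (fun h => hv' (h ▸ hv'')) h (hAD hh)
    have h3 := hu (φ' v)
    have := dist_triangle4 u (Ψ φ S v) (Ψ φ' S' v) (f (φ' v))
    rw [dist_comm] at h1
    linarith
  -- A gap `4e` between `φ` and `φ'` at `a` becomes `8e` between `g • f (φ a)` and `g • f (φ' a)`,
  -- then `6e` at `σ g a` after tracking, so the codes differ there and `σ g a` avoids both `B` and
  -- `N S`. Surgery moves each map by at most `e`, so `4e` survives.
  have hsepφ : ∀ S ⊆ C, ∀ φ ∈ P S, ∀ φ' ∈ P S, φ ≠ φ' →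
      ∃ a, 4 * e ≤ dist (Ψ φ S a) (Ψ φ' S a) := by
    intro S hS φ hφ φ' hφ' hne
    have hφ₀ := hPsub S hφ
    have hφ'₀ := hPsub S hφ'
    obtain ⟨a, ha⟩ := hZ φ (hP₀Z hφ₀) φ' (hP₀Z hφ'₀) hne
    have haB : a ∉ B := fun h =>
      absurd (hcode _ _ (hcodeB φ hφ₀ φ' hφ'₀ a h)).1 (not_lt.2 ha)
    obtain ⟨g, hg, hlt⟩ := hE _ _ ha
    have h1 := (hgood φ hφ₀ a haB).2 g (hEV hg)
    have h2 := (hgood φ' hφ'₀ a haB).2 g (hEV hg)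
    simp only [Function.comp_apply] at h1 h2
    have hb : 6 * e ≤ dist (f (φ (σ g a))) (f (φ' (σ g a))) := by
      have := dist_triangle4_left (f (φ (σ g a))) (f (φ' (σ g a))) (g • f (φ a))
        (g • f (φ' a))
      linarith
    have hncode : code (φ (σ g a)) ≠ code (φ' (σ g a)) := fun h =>
      absurd (hcode _ _ h).2 (not_lt.2 hb)
    have hbB : σ g a ∉ B := fun h => hncode (hcodeB φ hφ₀ φ' hφ'₀ _ h)
    have hbN : ∀ h ∈ A, ∀ v ∈ S, σ h v ≠ σ g a := fun h hh v hv heq =>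
      hncode (congrFun (hP S φ hφ φ' hφ')
        ⟨σ g a, Finset.mem_image₂.2 ⟨h, hh, v, hv, heq⟩⟩)
    have h3 := (hΨ φ S hφ₀ hS).2.2 _ hbB hbN
    have h4 := (hΨ φ' S hφ'₀ hS).2.2 _ hbB hbN
    have := dist_triangle4_left (Ψ φ S (σ g a)) (Ψ φ' S (σ g a)) (f (φ (σ g a)))
      (f (φ' (σ g a)))
    exact ⟨σ g a, by linarith⟩
  have hsep : ∀ x ∈ C.powerset.sigma P, ∀ y ∈ C.powerset.sigma P, x ≠ y →
      ∃ a, 4 * e ≤ dist (Ψ x.2 x.1 a) (Ψ y.2 y.1 a) := by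
    rintro ⟨S, φ⟩ hx ⟨S', φ'⟩ hy hne
    rw [Finset.mem_sigma, Finset.mem_powerset] at hx hy
    by_cases hSS : S = S'
    · subst hSS
      exact hsepφ S hx.1 φ hx.2 φ' hy.2 fun h => hne (h ▸ rfl)
    · by_cases hsub : S ⊆ S'
      · obtain ⟨v, hv, hv'⟩ := Finset.not_subset.1 fun h => hSS (hsub.antisymm h)
        refine ⟨v, ?_⟩
        rw [dist_comm]
        exact hsepS φ' (hPsub _ hy.2) φ (hPsub _ hx.2) S' hy.1 S hx.1 v hv hv'
      · obtain ⟨v, hv, hv'⟩ := Finset.not_subset.1 hsub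
        exact ⟨v, hsepS φ (hPsub _ hx.2) φ' (hPsub _ hy.2) S hx.1 S' hy.1 v hv hv'⟩
  have hinj : Set.InjOn (fun x : (_ : Finset (Fin d)) × (Fin d → X) => Ψ x.2 x.1)
      (C.powerset.sigma P : Finset _) := by
    intro x hx y hy hxy
    by_contra hne
    obtain ⟨a, ha⟩ := hsep x hx y hy hne
    have hxy : Ψ x.2 x.1 = Ψ y.2 y.1 := hxy
    rw [hxy, dist_self] at ha
    linarith
  refine ⟨(C.powerset.sigma P).image fun x => Ψ x.2 x.1, C.card, ?_, ?_, ?_, ?_⟩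
  · intro ψ hψ ψ' hψ' hne
    obtain ⟨x, hx, rfl⟩ := Finset.mem_image.1 hψ
    obtain ⟨y, hy, rfl⟩ := Finset.mem_image.1 hψ'
    exact hsep x hx y hy fun h => hne (h ▸ rfl)
  · intro ψ hψ
    obtain ⟨x, hx, rfl⟩ := Finset.mem_image.1 hψ
    rw [Finset.mem_sigma, Finset.mem_powerset] at hx
    exact ⟨B, hBcard, (hΨ _ _ (hPsub _ hx.2) hx.1).1⟩
  · have h1 : (d : ℝ) = Bᶜ.card + B.card := by
      have := Finset.card_compl_add_card B
      rw [Fintype.card_fin] at this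
      exact_mod_cast this.symm
    have h2 : (Bᶜ.card : ℝ) ≤ C.card * (2 * D.card + 1) := by exact_mod_cast hCcard
    linarith
  · rw [Finset.card_image_of_injOn hinj, Finset.card_sigma, ← sum_powerset_pow]
    have hL0 : 0 ≤ L := le_trans (Nat.cast_nonneg _) hL
    push_cast
    calc (Z.card : ℝ) * ∑ S ∈ C.powerset, ((M : ℝ) ^ A.card)⁻¹ ^ S.card
        ≤ L * P₀.card * ∑ S ∈ C.powerset, ((M : ℝ) ^ A.card)⁻¹ ^ S.card := by gcongr
      _ = L * ∑ S ∈ C.powerset, P₀.card * ((M : ℝ) ^ A.card)⁻¹ ^ S.card := by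
        rw [mul_assoc, Finset.mul_sum]
      _ ≤ L * ∑ S ∈ C.powerset, ((P S).card : ℝ) := by
        gcongr with S _
        exact hPcard' S

end Amplification

/-! ### Exponential growth rates and their drop. -/

section Growth

variable {G X : Type*} [Group G] [ρ : MetricSpace X] [MulAction G X]

/-- For suitable `F` and `δ`, separated families in `Map(X, ρ, F, δ, σ_j)` have at most
`exp (b d_j)` members for all large `j`. -/
def HasSeparatedGrowthLE (S : SoficApproximation G) (ρ : MetricSpace X) (ε b : ℝ) : Prop :=
  ∃ (F : Finset G) (δ : ℝ), 0 < δ ∧ ∀ᶠ j in atTop, ∀ Z : Finset (Fin (S.d j) → X),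
    (∀ φ ∈ Z, φ ∈ soficMap ρ F δ (S.σ j)) → IsPointwiseSeparated ε Z →
      (Z.card : ℝ) ≤ Real.exp (b * S.d j)

/-- Separated maps have distinct codes, so there are at most `M ^ d` of them, with no equivariance
needed. This starts the iteration. -/
theorem exists_hasSeparatedGrowthLE [CompactSpace X] [Nonempty X] (S : SoficApproximation G)
    {ε : ℝ} (hε : 0 < ε) : ∃ b, HasSeparatedGrowthLE S ρ ε b := by
  obtain ⟨M, code, hcode⟩ := exists_finite_code (X := X) hε
  have hM : 0 < M := Fin.pos (code (Classical.arbitrary X))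
  refine ⟨Real.log M, ∅, 1, one_pos, Eventually.of_forall fun j Z _ hZ => ?_⟩
  rw [mul_comm, Real.exp_nat_mul, Real.exp_log (by exact_mod_cast hM)]
  have := Finset.card_le_card_of_injOn (s := Z) (t := Finset.univ)
    (fun φ a => code (φ a)) (fun _ _ => Finset.mem_coe.2 (Finset.mem_univ _)) (by
      intro φ hφ ψ hψ h
      by_contra hne
      obtain ⟨a, ha⟩ := hZ φ hφ ψ hψ hne
      exact absurd (hcode _ _ (congrFun h a)) (not_lt.2 ha))
  rw [Finset.card_univ, Fintype.card_fun, Fintype.card_fin, Fintype.card_fin] at this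
  exact_mod_cast this

-- Since `f` commutes with the action, wherever `φ` is equivariant up to a modulus of continuity
-- `τ'`, `f ∘ φ` is so up to `τ`. The choice `δ = τ' √κ` makes the Chebyshev bound equal to `κ d`.
open Classical in
theorem eventually_card_exceptional_le {f : X → X} (hf : UniformContinuous f)
    (hfG : ∀ (g : G) (x : X), f (g • x) = g • f x) (S : SoficApproximation G) (V : Finset G)
    {τ θ : ℝ} (hτ : 0 < τ) (hθ : 0 < θ) :
    ∃ δ : ℝ, 0 < δ ∧ ∀ᶠ j in atTop, ∀ φ ∈ soficMap ρ V δ (S.σ j),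
      ((Finset.univ.filter fun a => ¬ (IsLocallyRegular (S.σ j) V a ∧
        TracksAt (S.σ j) V τ (f ∘ φ) a)).card : ℝ) ≤ θ * S.d j := by
  obtain ⟨τ', hτ', hmod⟩ := Metric.uniformContinuous_iff.1 hf τ hτ
  set κ : ℝ := θ / 2 / (V.card + 1) with hκ
  have hκ0 : 0 < κ := by positivity
  have hκV : V.card * κ ≤ θ / 2 := by
    have : κ * (V.card + 1) = θ / 2 := by rw [hκ]; field_simp
    linarith
  refine ⟨τ' * Real.sqrt κ, by positivity, ?_⟩
  filter_upwards [S.eventually_card_not_regular_le V (half_pos hθ)] with j hj φ hφ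
  have h1 := card_exists_le V (fun s a => τ' ≤ dist (φ (S.σ j s a)) (s • φ a))
    (m := κ * S.d j) (fun s hs => by
      have := card_le_of_mem_soficMap hφ hs hτ'
      rwa [mul_div_cancel_left₀ _ hτ'.ne', Real.sq_sqrt hκ0.le] at this)
  have hsub : (Finset.univ.filter fun a => ¬ (IsLocallyRegular (S.σ j) V a ∧
        TracksAt (S.σ j) V τ (f ∘ φ) a)) ⊆
      (Finset.univ.filter fun a => ¬ IsLocallyRegular (S.σ j) V a) ∪
      (Finset.univ.filter fun a => ∃ s ∈ V, τ' ≤ dist (φ (S.σ j s a)) (s • φ a)) := by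
    intro a ha
    by_contra hn
    simp only [Finset.mem_union, Finset.mem_filter, Finset.mem_univ, true_and, not_or, not_exists,
      not_and, not_not, not_le] at hn
    refine (Finset.mem_filter.1 ha).2 ⟨hn.1, fun s hs => ?_⟩
    rw [Function.comp_apply, Function.comp_apply, ← hfG]
    exact hmod (hn.2 s hs)
  calc _ ≤ θ / 2 * S.d j + V.card * (κ * S.d j) :=
        le_trans (by exact_mod_cast (Finset.card_le_card hsub).trans (Finset.card_union_le _ _))
          (add_le_add hj h1)
    _ = (θ / 2 + V.card * κ) * S.d j := by ring
    _ ≤ θ * S.d j := by gcongr; linarith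

variable [CompactSpace X] [ContinuousConstSMul G X]

/-- A non-surjective injective endomorphism forces a definite drop of the growth rate. -/
theorem exists_growth_drop {f : X → X} (hf : Continuous f)
    (hfG : ∀ (g : G) (x : X), f (g • x) = g • f x) (hinj : Function.Injective f)
    {u : X} {e : ℝ} (he : 0 < e) (hu : ∀ x, 8 * e ≤ dist u (f x))
    (hE : ∀ x y : X, x ≠ y → ∃ g : G, 8 * e < dist (g • x) (g • y))
    (hW : ∀ ε : ℝ, 0 < ε → ∃ F : Set G, F.Finite ∧ F⁻¹ = F ∧ 1 ∈ F ∧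
      ∀ (n : ℕ) (Ω : Fin n → Set G), (∀ i, (Ω i).Finite) →
        (∀ i j, i ≠ j → (F * Ω i) ∩ Ω j = ∅) →
        ∀ x : Fin n → X, ∃ z : X, ∀ i, ∀ s ∈ Ω i, dist (s • z) (s • x i) ≤ ε)
    (hM : ∀ ε : ℝ, 0 < ε → ∃ δ : ℝ, 0 < δ ∧ ∃ F : Set G, F.Finite ∧ 1 ∈ F ∧
      ∀ (A : Set G), A.Finite → ∀ x y : X,
        (∀ s ∈ (F * A) \ A, dist (s • x) (s • y) ≤ δ) →
        ∃ z : X, (∀ s ∈ F * A, dist (s • z) (s • x) ≤ ε) ∧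
          (∀ s ∈ Aᶜ, dist (s • z) (s • y) ≤ ε))
    (S : SoficApproximation G) :
    ∃ γ : ℝ, 0 < γ ∧ ∀ b, HasSeparatedGrowthLE S ρ (4 * e) b →
      HasSeparatedGrowthLE S ρ (4 * e) (b - γ) := by
  classical
  have hfu : UniformContinuous f := CompactSpace.uniformContinuous_of_continuous hf
  obtain ⟨A, D, hAD, hsurg⟩ := exists_sofic_surgery hE hW hM u he (by linarith)
  obtain ⟨E, hEsep⟩ := exists_finset_separating hE hf hinj (show 0 < 4 * e by linarith)
  obtain ⟨r, hr, hfr⟩ := Metric.uniformContinuous_iff.1 hfu (6 * e) (by linarith)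
  obtain ⟨M, code, hcode⟩ := exists_finite_code (X := X)
    (lt_min (show 0 < 4 * e by linarith) hr)
  have hM1 : 0 < M := Fin.pos (code u)
  set k : ℝ := ((M : ℝ) ^ A.card)⁻¹ with hk
  have hk0 : 0 < k := by positivity
  have hlog : 0 < Real.log (1 + k) := Real.log_pos (by linarith)
  -- With at most half of the points exceptional, `n ≥ d / (2 (2 |D| + 1))`, so the gain is at least
  -- `exp (2γd)`. The pigeonhole loss is `exp (γd)`, which leaves a net `γ`. None of these constants
  -- involves `b`, `F` or `δ`.
  set γ : ℝ := 1 / (2 * (2 * D.card + 1)) * Real.log (1 + k) / 2 with hγ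
  have hγ0 : 0 < γ := by positivity
  obtain ⟨θ₀, hθ₀, hsparse⟩ := exists_card_sparse_le M hγ0
  refine ⟨γ, hγ0, fun b hb => ?_⟩
  obtain ⟨F, δ, hδ, hb⟩ := hb
  obtain ⟨Δ, hΔ⟩ : ∃ Δ : ℝ, ∀ x y : X, dist x y ≤ Δ :=
    ⟨Metric.diam (Set.univ : Set X), fun x y =>
      Metric.dist_le_diam_of_mem isCompact_univ.isBounded (Set.mem_univ x) (Set.mem_univ y)⟩
  -- Three demands on the exceptional density: cheap pigeonhole, at least half of the points usable,
  -- and negligible weight in `ρ₂` next to errors `δ / 2` elsewhere.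
  obtain ⟨θ, hθ, hθθ₀, hθ2, hθΔ⟩ : ∃ θ : ℝ, 0 < θ ∧ θ ≤ θ₀ ∧ θ ≤ 1 / 2 ∧
      (δ / 2) ^ 2 + 2 * θ * Δ ^ 2 < δ ^ 2 := by
    refine ⟨min θ₀ (min (1 / 2) (δ ^ 2 / 4 / (2 * Δ ^ 2 + 1))), by positivity, min_le_left _ _,
      (min_le_right _ _).trans (min_le_left _ _), ?_⟩
    have h1 : min θ₀ (min (1 / 2) (δ ^ 2 / 4 / (2 * Δ ^ 2 + 1))) ≤ δ ^ 2 / 4 / (2 * Δ ^ 2 + 1) :=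
      (min_le_right _ _).trans (min_le_right _ _)
    have h0 : 0 < min θ₀ (min (1 / 2) (δ ^ 2 / 4 / (2 * Δ ^ 2 + 1))) := by positivity
    rw [le_div_iff₀ (by positivity)] at h1
    have h2 : 0 < δ ^ 2 := by positivity
    linarith
  obtain ⟨V, τ, hτ, hsurg⟩ := hsurg F (δ / 2) (half_pos hδ)
  obtain ⟨δ₁, hδ₁, hexc⟩ := eventually_card_exceptional_le hfu hfG S (V ∪ E)
    (lt_min hτ he) hθ
  refine ⟨V ∪ E, δ₁, hδ₁, ?_⟩
  filter_upwards [hb, hexc] with j hbj hexcj Z hZmap hZ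
  obtain ⟨Z', n, hZ', hmap, hn, hcard⟩ := exists_larger_separated_family (F := F) (δ := δ / 2) he
    (min_le_right τ e) hθ.le hu
    (fun x y h => ⟨(hcode x y h).trans_le (min_le_left _ _),
      hfr ((hcode x y h).trans_le (min_le_right _ _))⟩) hAD
    (Finset.subset_union_right (s₁ := V)) hEsep
    (fun ψ R T hreg htr hT => hsurg (S.σ j) ψ R T
      (fun a ha => (hreg a ha).mono Finset.subset_union_left)
      (fun a ha => (htr a ha).mono Finset.subset_union_left (min_le_left _ _)) hT)
    (L := Real.exp (γ * S.d j))
    ((card_filter_le_card_filter fun p hp => hp.trans (by gcongr)).trans (hsparse (S.d j)))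
    hZ (fun φ hφ => hexcj φ (hZmap φ hφ))
  have hd : (0 : ℝ) < S.d j := by exact_mod_cast S.d_pos j
  have hZ'card := hbj Z' (fun ψ hψ => by
    obtain ⟨B, hB, h⟩ := hmap ψ hψ
    exact mem_soficMap_of_small_exception (S.d_pos j) hδ hΔ hθΔ hB h) hZ'
  have hn' : 1 / (2 * (2 * D.card + 1)) * (S.d j : ℝ) ≤ n := by
    rw [one_div, inv_mul_le_iff₀ (by positivity)]
    have : θ * S.d j ≤ 1 / 2 * S.d j := by gcongr
    linarith
  have hpow : Real.exp (2 * γ * S.d j) ≤ (1 + k) ^ n := by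
    rw [← Real.exp_log (show 0 < (1 + k) ^ n by positivity), Real.log_pow]
    apply Real.exp_le_exp.2
    calc 2 * γ * S.d j = 1 / (2 * (2 * D.card + 1)) * (S.d j : ℝ) * Real.log (1 + k) := by
          rw [hγ]; ring
      _ ≤ n * Real.log (1 + k) := by gcongr
  have h : (Z.card : ℝ) * Real.exp (2 * γ * S.d j) ≤ Real.exp ((γ + b) * S.d j) := by
    calc (Z.card : ℝ) * Real.exp (2 * γ * S.d j) ≤ Z.card * (1 + k) ^ n := by gcongr
      _ ≤ Real.exp (γ * S.d j) * Z'.card := hcard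
      _ ≤ Real.exp (γ * S.d j) * Real.exp (b * S.d j) := by gcongr
      _ = Real.exp ((γ + b) * S.d j) := by rw [← Real.exp_add]; ring_nf
  rw [← le_div_iff₀ (Real.exp_pos _), ← Real.exp_sub] at h
  refine h.trans (le_of_eq ?_)
  ring_nf

end Growth

/-! ### Conclusion from nonnegative entropy. -/

theorem soficMap_insert_subset {G X : Type*} [Group G] [MulAction G X] [DecidableEq G]
    (ρ : MetricSpace X) (F : Finset G) (g : G) (δ : ℝ) {d : ℕ} (σ : G → Equiv.Perm (Fin d)) :
    soficMap ρ (insert g F) δ σ ⊆ soficMap ρ F δ σ :=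
  fun _ hφ s hs => hφ s (Finset.mem_insert_of_mem hs)

/-- Nonnegative entropy provides approximately equivariant maps. -/
theorem frequently_soficMap_nonempty {G X : Type*} [Group G] [MulAction G X]
    {S : SoficApproximation G} {ρ : MetricSpace X} (h : 0 ≤ soficEntropyOf S ρ) {F : Finset G}
    (hF : F.Nonempty) {δ : ℝ} (hδ : 0 < δ) :
    ∃ᶠ j in atTop, (soficMap ρ F δ (S.σ j)).Nonempty := by
  by_contra hn
  rw [not_frequently] at hn
  have hbot : soficEntropyOf S ρ ≤ ⊥ := by
    refine iSup₂_le fun ε _ => (iInf₂_le F hF).trans ((iInf₂_le δ hδ).trans ?_)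
    refine le_of_eq (Eq.trans (limsup_congr (v := fun _ => (⊥ : EReal)) ?_) limsup_const_bot)
    filter_upwards [hn] with j hj
    have h0 : maxSeparated ρ ε (soficMap ρ F δ (S.σ j)) = 0 := by
      rw [Set.not_nonempty_iff_eq_empty] at hj
      simp only [maxSeparated, hj, ENat.iSup_eq_zero]
      intro Z hZ _
      rw [Set.subset_empty_iff, Finset.coe_eq_empty] at hZ
      simp [hZ]
    rw [h0]
    simp only [ENat.toENNReal_zero, ENNReal.log_zero]
    exact EReal.bot_div_of_pos_ne_top (by exact_mod_cast S.d_pos j) (EReal.natCast_ne_top _)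
  exact absurd (h.trans hbot) (by simp)

theorem theorem1p1 {G X : Type*} [Group G] [Countable G]
    [TopologicalSpace X] [CompactSpace X] [TopologicalSpace.MetrizableSpace X]
    [MulAction G X] [ContinuousConstSMul G X]
    (hG : IsSoficGroup G)
    (hexp : IsExpansiveAction G X)
    (hwsp : HasWeakSpecification G X)
    (hstmp : HasStrongTMP G X)
    (hent : ∃ S : SoficApproximation G, 0 ≤ soficEntropy S X) :
    IsSurjunctiveAction G X := by
  classical
  obtain ⟨S, hS⟩ := hent
  have hρ : IsCompatibleMetric (TopologicalSpace.metrizableSpaceMetric X) := rfl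
  obtain ⟨c, hc, hE⟩ := hexp.of_compatible hρ
  have hW := hwsp.of_compatible hρ
  have hM := hstmp.of_compatible hρ
  have hmap := fun (F : Finset G) (hF : F.Nonempty) (δ : ℝ) (hδ : 0 < δ) =>
    frequently_soficMap_nonempty (S := S) hS hF hδ
  let _ : MetricSpace X := TopologicalSpace.metrizableSpaceMetric X
  intro f hf hfG hinj
  by_contra hsurj
  obtain ⟨u, hu⟩ : ∃ u, u ∉ Set.range f := by
    simpa [Function.Surjective] using hsurj
  obtain ⟨r, hr, hball⟩ := Metric.isOpen_iff.1 (isCompact_range hf).isClosed.isOpen_compl u hu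
  have hru : ∀ x, r ≤ dist u (f x) := fun x => by
    by_contra hlt
    exact hball (Metric.mem_ball'.2 (not_le.1 hlt)) ⟨x, rfl⟩
  obtain ⟨e, he, hec, her⟩ : ∃ e : ℝ, 0 < e ∧ 8 * e ≤ c ∧ 8 * e ≤ r :=
    ⟨min c r / 8, by positivity, by linarith [min_le_left c r], by linarith [min_le_right c r]⟩
  obtain ⟨γ, hγ, hdrop⟩ := exists_growth_drop hf hfG hinj he (fun x => her.trans (hru x))
    (fun x y hxy => (hE x y hxy).imp fun g hg => hec.trans_lt hg) hW hM S
  have : Nonempty X := ⟨u⟩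
  obtain ⟨b, hb⟩ := exists_hasSeparatedGrowthLE (X := X) S (show 0 < 4 * e by linarith)
  have hbn : ∀ n : ℕ, HasSeparatedGrowthLE S ‹MetricSpace X› (4 * e) (b - n * γ) := by
    intro n
    induction n with
    | zero => simpa using hb
    | succ n ih =>
      convert hdrop _ ih using 1
      push_cast
      ring
  obtain ⟨n, hn⟩ := exists_nat_gt (b / γ)
  rw [div_lt_iff₀ hγ] at hn
  obtain ⟨F, δ, hδ, hgrowth⟩ := hbn n
  -- The growth bound may come with an empty `F`, while the entropy uses nonempty ones; inserting
  -- `1` bridges this. A single map is already a separated family, against a bound below `1`.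
  obtain ⟨j, ⟨φ, hφ⟩, hj⟩ :=
    ((hmap (insert 1 F) (Finset.insert_nonempty _ _) δ hδ).and_eventually hgrowth).exists
  have h1 := hj {φ}
    (fun ψ hψ => Finset.mem_singleton.1 hψ ▸ soficMap_insert_subset _ F 1 δ (S.σ j) hφ)
    (fun ψ hψ ψ' hψ' hne => absurd
      ((Finset.mem_singleton.1 hψ).trans (Finset.mem_singleton.1 hψ').symm) hne)
  have hd : (0 : ℝ) < S.d j := by exact_mod_cast S.d_pos j
  have h2 : Real.exp ((b - n * γ) * S.d j) < 1 :=
    Real.exp_lt_one_iff.2 (mul_neg_of_neg_of_pos (by linarith) hd)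
  rw [Finset.card_singleton, Nat.cast_one] at h1
  linarith
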